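/- Theorem 12 (Main Result). All digraphs are finite and have no loops and no multiple arcs (pairs of opposite arcs are allowed). For a vertex $x$ of a digraph $D$ let $d^+(x)$ and $d^-(x)$ be its out-degree and in-degree, and let $d(x)=d^+(x)+d^-(x)$. Two distinct vertices $x,y$ are adjacent if at least one of $xy$, $yx$ is an arc of $D$. Let $D$ be a strongly connected digraph of order $n\geq 4$ such that $d^+(x)\geq 2$ and $d^-(x)\geq 3$ for every vertex $x$. Suppose that $$\min\{d(x),d(y)\}\geq n-1\quad\text{and}\quad d(x)+d(y)\geq 2n-1$$ for every pair of distinct non-adjacent vertices $x,y$ with a common in-neighbour (a vertex $z$ such that $zx$ and $zy$ are arcs of $D$). Then $D$ contains a Hamiltonian bypass, i.e., a spanning subdigraph which is obtained from a directed cycle $x_1x_2\ldots x_nx_1$ through all the vertices of $D$ (whose arcs need not all belong to $D$) by reversing exactly one arc; in other words, the vertices of $D$ can be ordered $x_1,x_2,\ldots,x_n$ so that $x_1x_2,\,x_2x_3,\ldots,x_{n-1}x_n$ and $x_1x_n$ are arcs of $D$. -/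

import Mathlib

namespace Digraph

variable {V : Type*}

/-- `D` has no loops. (Multiple arcs are impossible for a `Digraph`, while a pair of opposite
arcs is allowed.) -/
def Loopless (D : Digraph V) : Prop := ∀ v, ¬ D.Adj v v

/-- The out-degree `d⁺(x)`: the number of out-neighbours of `x`. -/
noncomputable def outDeg (D : Digraph V) (x : V) : ℕ := {y | D.Adj x y}.ncard

/-- The in-degree `d⁻(x)`: the number of in-neighbours of `x`. -/
noncomputable def inDeg (D : Digraph V) (x : V) : ℕ := {y | D.Adj y x}.ncard

/-- The degree `d(x) = d⁺(x) + d⁻(x)`. -/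
noncomputable def deg (D : Digraph V) (x : V) : ℕ := D.outDeg x + D.inDeg x

/-- `D` is strong: every vertex can be reached from every vertex along arcs of `D`. -/
def Strong (D : Digraph V) : Prop := ∀ x y, Relation.ReflTransGen D.Adj x y

/-- Two distinct vertices are non-adjacent if there is no arc between them in either direction. -/
def NonAdjacent (D : Digraph V) (x y : V) : Prop := x ≠ y ∧ ¬ D.Adj x y ∧ ¬ D.Adj y x

/-- Some vertex dominates both `x` and `y`. -/
def HasCommonInNeighbour (D : Digraph V) (x y : V) : Prop := ∃ z, D.Adj z x ∧ D.Adj z y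

/-- `C` is a directed cycle `x₁x₂…xₙx₁` through all the vertices of `V`: its arcs are exactly
the arcs `xᵢxᵢ₊₁` (indices modulo `n`), where `x₁, …, xₙ` lists every vertex exactly once. -/
def IsHamiltonianCycle (C : Digraph V) : Prop :=
  ∃ (n : ℕ) (x : Fin n ≃ V), 2 ≤ n ∧
    ∀ u v, C.Adj u v ↔ ∃ i, x i = u ∧ x (finRotate n i) = v

/-- The digraph obtained from `C` by replacing the arc `ab` by the arc `ba`. -/
def reverseArc (C : Digraph V) (a b : V) : Digraph V where
  Adj u v := (C.Adj u v ∧ ¬ (u = a ∧ v = b)) ∨ (u = b ∧ v = a)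

/-- `H` is obtained from a directed cycle through all the vertices by reversing exactly one arc
(the cycle has length at least three, so that the reversed arc is not already on it). -/
def IsHamiltonianBypass (H : Digraph V) : Prop :=
  ∃ (C : Digraph V) (a b : V), 3 ≤ Nat.card V ∧ C.IsHamiltonianCycle ∧ C.Adj a b ∧
    H = C.reverseArc a b

/-- `D` contains a Hamiltonian bypass as a (spanning) subdigraph. The cycle from which the
bypass arises need not lie in `D`. -/
def ContainsHamiltonianBypass (D : Digraph V) : Prop :=
  ∃ H : Digraph V, H.IsHamiltonianBypass ∧ H ≤ D

end Digraph

/-! Suppose that no Hamiltonian path has an arc from its first to its last vertex (`BypassFree`).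
The contradiction comes from two facts: `D` has a Hamiltonian cycle
(`DominatedPairCondition.exists_isClosedChain`), and it cannot have one
(`BypassFree.not_isClosedChain`).

Hamiltonicity does not involve bypasses. By strong connectivity, a longest cycle that misses a
vertex has an ear; take one skipping as few cycle vertices as possible. Its first inner vertex `p`
is adjacent to none of the skipped vertices, and a degree count (`IsShortestEar.deg_add_deg_le`)
shows that these can be inserted one by one into the rest of the cycle. The ear then closes a longer
cycle.

For the second fact, let a cycle miss only `v`. Bypass-freeness forbids consecutive out-neighbours
of `v` on it, and consecutive in-neighbours, so `d(v) ≤ n - 1`. The degree condition then yields the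
main tool `BypassFree.adj_of_adj`: a cycle vertex dominating `v` has its successor dominated by `v`.
Choose a Hamiltonian cycle with a chord `k i` for which the segment `I` between `i` and `k` is
shortest. If all of `I` could be inserted into the path from `k` to `i`, the result would be a
bypass (`List.exists_multi_insertion`). A vertex that cannot be inserted must be the first of `I`
and be dominated by the predecessor of `i` (`BypassFree.insertable_or`,
`IsShortestChord.exists_cons`). Moving `i` behind `k` gives another shortest chord, and a third
in-neighbour finishes the proof. -/

namespace List

/-! ### Paths as lists: consecutive pairs, insertion, counting. -/

variable {V : Type*} {r : V → V → Prop}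

/-- Used with `P` meaning "dominates `u`": for `u` not insertable in a path, the pair found makes
`b` non-adjacent to `u`, with common in-neighbour `a`. -/
theorem exists_consecutive_of_mem_of_not_getLast {P : V → Prop} :
    ∀ {L : List V} (hne : L ≠ []), (∃ x ∈ L, P x) → ¬ P (L.getLast hne) →
      ∃ a b, [a, b] <:+: L ∧ P a ∧ ¬ P b
  | [x], _, ⟨y, hy, hP⟩, hl => by
      simp only [mem_singleton] at hy
      subst hy
      exact absurd hP hl
  | x :: y :: L, _, ⟨z, hz, hP⟩, hl => by
      by_cases hx : P x ∧ ¬ P y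
      · exact ⟨x, y, ⟨[], L, rfl⟩, hx.1, hx.2⟩
      · have : ∃ z ∈ y :: L, P z := by
          rcases mem_cons.1 hz with rfl | hz
          · exact ⟨y, mem_cons_self, by tauto⟩
          · exact ⟨z, hz, hP⟩
        obtain ⟨a, b, hab, h⟩ := exists_consecutive_of_mem_of_not_getLast (L := y :: L)
          (by simp) this (by simpa using hl)
        exact ⟨a, b, hab.trans (suffix_cons x _).isInfix, h⟩

theorem pair_infix_append {A B : List V} {a b : V} (h : [a, b] <:+: A ++ B) :
    [a, b] <:+: A ∨ [a, b] <:+: B ∨ (∃ A' B', A = A' ++ [a] ∧ B = b :: B') := by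
  obtain ⟨S, T, h⟩ := h
  rw [append_assoc] at h
  rcases append_eq_append_iff.1 h with ⟨U, h1, h2⟩ | ⟨U, h1, h2⟩
  · rcases U with _ | ⟨c, U⟩
    · exact .inr (.inl ⟨[], T, by simpa using h2⟩)
    · rcases U with _ | ⟨d, U⟩
      · simp only [cons_append, nil_append, cons.injEq] at h2
        obtain ⟨rfl, h2⟩ := h2
        exact .inr (.inr ⟨S, T, h1, h2.symm⟩)
      · simp only [cons_append, nil_append, cons.injEq] at h2
        obtain ⟨rfl, rfl, h2⟩ := h2
        exact .inl ⟨S, U, by simp [h1]⟩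
  · exact .inr (.inl ⟨U, T, by simp [h2]⟩)

/-- `v` can be inserted between two consecutive members of `L`. -/
def Insertable (r : V → V → Prop) (L : List V) (v : V) : Prop :=
  ∃ a b, [a, b] <:+: L ∧ r a v ∧ r v b

theorem exists_max_prefix {P : V → Prop} :
    ∀ {L : List V}, (∃ x ∈ L, P x) → ∃ J w K, L = J ++ w :: K ∧ P w ∧ ∀ x ∈ K, ¬ P x
  | [], ⟨x, hx, _⟩ => by simp at hx
  | y :: L, h => by
      by_cases hL : ∃ x ∈ L, P x
      · obtain ⟨J, w, K, rfl, hw, hK⟩ := exists_max_prefix hL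
        exact ⟨y :: J, w, K, rfl, hw, hK⟩
      · push Not at hL
        obtain ⟨x, hx, hP⟩ := h
        rcases mem_cons.1 hx with rfl | hx
        · exact ⟨[], x, L, rfl, hP, hL⟩
        · exact absurd hP (hL x hx)

theorem IsChain.insert {A B J : List V} {x y v w : V} (h : IsChain r (A ++ x :: y :: B))
    (hJ : IsChain r (J ++ [w])) (hv : (J ++ [w]).head? = some v) (hxv : r x v) (hwy : r w y) :
    IsChain r (A ++ x :: (J ++ w :: y :: B)) := by
  rw [isChain_append_cons_cons] at h
  obtain ⟨h1, -, h2⟩ := h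
  rw [isChain_split]
  refine ⟨h1, ?_⟩
  have h3 : IsChain r (J ++ w :: y :: B) := by
    rw [isChain_append_cons_cons]
    exact ⟨hJ, hwy, h2⟩
  refine h3.cons fun z hz => ?_
  have : z = v := by
    cases J <;> simp_all
  exact this ▸ hxv

/-- Multi-insertion: if every member of a path `I` can be inserted into the path `Q`, then there
is a path with the same ends as `Q` through the vertices of `Q` and `I`. -/
theorem exists_multi_insertion : ∀ (n : ℕ) (I : List V), I.length ≤ n → ∀ Q : List V,
    IsChain r I → IsChain r Q → (∀ v ∈ I, Insertable r Q v) →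
      ∃ Q', IsChain r Q' ∧ Q' ~ Q ++ I ∧ Q'.head? = Q.head? ∧ Q'.getLast? = Q.getLast?
  | _, [], _, Q, _, hQ, _ => ⟨Q, hQ, by simp, rfl, rfl⟩
  | 0, v :: I, hn, _, _, _, _ => by simp at hn
  | n + 1, v :: I, hn, Q, hI, hQ, hins => by
      obtain ⟨x, y, ⟨A, B, hAB⟩, hxv, hvy⟩ := hins v mem_cons_self
      have hAB' : Q = A ++ x :: y :: B := by simp [← hAB]
      -- With `w` the last vertex of `I` that fits between `x` and `y`, the whole initial segment of
      -- `I` up to `w` goes there as a block. No vertex of the remainder `K` needs the destroyed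
      -- pair `x`, `y`, so induction applies to `K`.
      obtain ⟨J, w, K, hJK, hw, hK⟩ := exists_max_prefix (P := fun w => r x w ∧ r w y)
        (L := v :: I) ⟨v, mem_cons_self, hxv, hvy⟩
      have hIJ : IsChain r (J ++ w :: K) := hJK ▸ hI
      rw [isChain_split] at hIJ
      have hQ1 : IsChain r (A ++ x :: (J ++ w :: y :: B)) := by
        refine IsChain.insert (hAB' ▸ hQ) hIJ.1 (v := v) ?_ hxv hw.2
        have := congrArg head? hJK
        cases J <;> simp_all
      obtain ⟨Q', h1, h2, h3, h4⟩ := exists_multi_insertion n K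
        (by have := congrArg length hJK; simp at this hn; omega) _ hIJ.2.tail hQ1 (by
          intro u hu
          obtain ⟨a, b, hab, hau, hub⟩ := hins u (by rw [hJK]; simp [hu])
          refine ⟨a, b, ?_, hau, hub⟩
          have e : Q = (A ++ [x]) ++ y :: B := by simp [hAB']
          rw [e] at hab
          rcases pair_infix_append hab with h | h | ⟨A', B', h, h'⟩
          · exact h.trans ⟨[], J ++ w :: y :: B, by simp⟩
          · exact h.trans ⟨A ++ x :: (J ++ [w]), [], by simp⟩
          · obtain ⟨-, h⟩ := append_inj' h rfl
            simp only [cons.injEq, and_true] at h h'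
            exact absurd ⟨h ▸ hau, h'.1 ▸ hub⟩ (hK u hu))
      refine ⟨Q', h1, h2.trans ?_, h3.trans ?_, h4.trans ?_⟩
      · classical
        rw [hAB', hJK, perm_iff_count]
        intro a
        simp only [count_append, count_cons]
        omega
      · rw [hAB']; cases A <;> simp
      · rw [hAB']; simp [getLast?_append, getLast?_cons]

open Classical in
/-- If `P a` and `Q b` never hold for consecutive `a`, `b` in `L`, then `P` and `Q` together hold
at most `L.length - 1` times, up to the contributions of the two ends. -/
theorem exists_countP_add_countP_le {P Q : V → Prop} :
    ∀ {L : List V} (hne : L ≠ []), (∀ a b, [a, b] <:+: L → ¬ (P a ∧ Q b)) →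
      ∃ e f : ℕ, e ≤ 1 ∧ f ≤ 1 ∧ (e = 1 → P (L.getLast hne)) ∧ (f = 1 → Q (L.head hne)) ∧
        L.countP (fun a => P a) + L.countP (fun a => Q a) + 1 ≤ L.length + e + f
  | [x], _, _ => by
      refine ⟨if P x then 1 else 0, if Q x then 1 else 0, ?_⟩
      by_cases h1 : P x <;> by_cases h2 : Q x <;> simp [h1, h2]
  | x :: y :: L, _, h => by
      obtain ⟨e, f, he, hf, hP, hQ, hc⟩ := exists_countP_add_countP_le (P := P) (Q := Q)
        (L := y :: L) (by simp) fun a b hab => h a b (hab.trans (suffix_cons x _).isInfix)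
      have hxy := h x y ⟨[], L, rfl⟩
      simp only [head_cons, getLast_cons_cons] at hP hQ ⊢
      refine ⟨e, if Q x then 1 else 0, he, by split_ifs <;> simp, hP, by simp, ?_⟩
      rw [countP_cons (a := x), countP_cons (a := x)]
      simp only [length_cons, decide_eq_true_eq] at hc ⊢
      by_cases h1 : P x
      · have : f ≠ 1 := fun h => hxy ⟨h1, hQ h⟩
        by_cases h2 : Q x <;> simp only [h1, h2, if_true, if_false] <;> omega
      · by_cases h2 : Q x <;> simp only [h1, h2, if_true, if_false] <;> omega

-- The cycle is opened between `s` and `t` into a path from `t` to `s`; the two end corrections of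
-- `exists_countP_add_countP_le` cannot both occur, and neither occurs if `P` fails at `s` and `t`.
open Classical in
theorem two_mul_countP_le {P : V → Prop} {s t : V} {W : List V}
    (h : ∀ a b, [a, b] <:+: t :: (W ++ [s]) → ¬ (P a ∧ P b)) (hst : ¬ (P s ∧ P t)) :
    2 * (s :: t :: W).countP (fun a => P a) ≤ (s :: t :: W).length ∧
      (¬ P s → ¬ P t → 2 * (s :: t :: W).countP (fun a => P a) + 1 ≤ (s :: t :: W).length) := by
  obtain ⟨e, f, he, hf, h1, h2, hc⟩ := exists_countP_add_countP_le (by simp) h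
  have hcount : (t :: (W ++ [s])).countP (fun a => P a) =
      (s :: t :: W).countP (fun a => P a) := by
    simp only [countP_append, countP_cons, countP_nil]; omega
  rw [hcount] at hc
  simp only [length_cons, length_append, length_nil] at hc ⊢
  simp only [head_cons] at h2
  have h3 : e = 1 → P s := fun h => by simpa using h1 h
  constructor
  · have : ¬ (e = 1 ∧ f = 1) := fun h => hst ⟨h3 h.1, h2 h.2⟩
    omega
  · intro h4 h5
    have : e ≠ 1 := fun h => h4 (h3 h)
    have : f ≠ 1 := fun h => h5 (h2 h)
    omega

theorem perm_of_forall_count [DecidableEq V] {A B : List V} (h : ∀ a, count a A = count a B) :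
    A ~ B := perm_iff_count.2 h

/-! ### Cycles as closed chains. -/

/-- `r` holds between cyclically consecutive members of `L`. -/
def IsClosedChain (r : V → V → Prop) (L : List V) : Prop := Cycle.Chain r (L : Cycle V)

theorem isClosedChain_cons {a : V} {L : List V} :
    IsClosedChain r (a :: L) ↔ IsChain r (a :: (L ++ [a])) := Cycle.chain_coe_cons _ _ _

theorem IsClosedChain.append_comm {A B : List V} (h : IsClosedChain r (A ++ B)) :
    IsClosedChain r (B ++ A) := by
  have : ((A ++ B : List V) : Cycle V) = ((B ++ A : List V) : Cycle V) :=
    Cycle.coe_eq_coe.2 isRotated_append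
  unfold IsClosedChain at *
  rwa [← this]

theorem IsClosedChain.isChain {L : List V} (h : IsClosedChain r L) : IsChain r L := by
  cases L with
  | nil => exact .nil
  | cons a L => exact (isClosedChain_cons.1 h).prefix ⟨[a], by simp⟩

theorem isClosedChain_of_isChain {a b : V} {L : List V} (h : IsChain r (a :: (L ++ [b])))
    (hba : r b a) : IsClosedChain r (a :: (L ++ [b])) := by
  rw [isClosedChain_cons, append_assoc]
  simp only [cons_append, nil_append]
  rw [isChain_cons_append_cons_cons]
  exact ⟨h, hba, by simp⟩

/-- Remove or replace the part of a closed chain between two members. -/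
theorem IsClosedChain.replace {A B M : List V} {x y : V}
    (h : IsClosedChain r (A ++ x :: (M ++ y :: B))) {M' : List V}
    (hM : IsChain r (x :: (M' ++ [y]))) : IsClosedChain r (A ++ x :: (M' ++ y :: B)) := by
  have h1 : IsClosedChain r (y :: (B ++ A ++ x :: M)) := by
    have := IsClosedChain.append_comm (A := A ++ x :: M) (B := y :: B) (by simpa using h)
    simpa using this
  rw [isClosedChain_cons] at h1
  have h2 : IsChain r (y :: (B ++ A) ++ [x]) := by
    refine h1.prefix ⟨M ++ [y], by simp⟩
  have h3 : IsClosedChain r ((y :: B) ++ (A ++ x :: M')) := by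
    rw [cons_append, isClosedChain_cons]
    have : IsChain r ((y :: (B ++ A)) ++ x :: (M' ++ [y])) := by
      rw [isChain_split]
      exact ⟨h2, hM⟩
    simpa using this
  simpa using h3.append_comm

/-- Insert `v` between consecutive members of a closed chain. -/
theorem IsClosedChain.insert {A B : List V} {x y v : V}
    (h : IsClosedChain r (A ++ x :: y :: B)) (hx : r x v) (hy : r v y) :
    IsClosedChain r (A ++ x :: v :: y :: B) :=
  IsClosedChain.replace (M := []) (M' := [v]) h (by simp [hx, hy])

end List

/-! ### Bypass-free digraphs and a cycle missing one vertex. -/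

namespace Digraph

variable {V : Type*} {D : Digraph V}

/-- `L` lists every vertex exactly once. -/
def Spans (L : List V) : Prop := L.Nodup ∧ ∀ x, x ∈ L

theorem Spans.perm {L L' : List V} (h : Spans L) (hp : L'.Perm L) : Spans L' :=
  ⟨hp.nodup_iff.2 h.1, fun x => hp.mem_iff.2 (h.2 x)⟩

theorem Spans.length_eq [Fintype V] {L : List V} (h : Spans L) : L.length = Fintype.card V := by
  classical
  rw [← List.toFinset_card_of_nodup h.1, ← Finset.card_univ]
  congr 1
  ext x
  simp [h.2 x]

theorem Spans.ncard_eq {L : List V} (h : Spans L) (P : V → Prop) [DecidablePred P] :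
    {y | P y}.ncard = L.countP (fun y => P y) := by
  classical
  rw [List.countP_eq_length_filter, ← List.toFinset_card_of_nodup (h.1.filter _),
    ← Set.ncard_coe_finset]
  congr 1
  ext x
  simp [h.2 x]

open Classical in
theorem Spans.outDeg_eq {v : V} {C : List V} (hl : D.Loopless) (h : Spans (v :: C)) :
    D.outDeg v = C.countP (fun y => D.Adj v y) := by
  rw [outDeg, h.ncard_eq (fun y => D.Adj v y), List.countP_cons_of_neg (by simpa using hl v)]

open Classical in
theorem Spans.inDeg_eq {v : V} {C : List V} (hl : D.Loopless) (h : Spans (v :: C)) :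
    D.inDeg v = C.countP (fun y => D.Adj y v) := by
  rw [inDeg, h.ncard_eq (fun y => D.Adj y v), List.countP_cons_of_neg (by simpa using hl v)]

/-- No Hamiltonian path of `D` has an arc from its first to its last vertex. -/
def BypassFree (D : Digraph V) : Prop :=
  ∀ (a b : V) (L : List V), (a :: (L ++ [b])).IsChain D.Adj → Spans (a :: (L ++ [b])) →
    ¬ D.Adj a b

theorem containsHamiltonianBypass_of_not_bypassFree [Fintype V] (hcard : 3 ≤ Fintype.card V)
    (h : ¬ D.BypassFree) : D.ContainsHamiltonianBypass := by
  classical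
  simp only [BypassFree, not_forall, not_not] at h
  obtain ⟨a, b, L, hc, hs, hab⟩ := h
  set M := a :: (L ++ [b]) with hM
  let x : Fin (L.length + 1 + 1) ≃ V :=
    (finCongr (by simp [hM])).trans (hs.1.getEquivOfForallMemList M hs.2)
  have hx : ∀ i : Fin (L.length + 1 + 1), x i = M[i.1]'(by have := i.2; simp [hM]; omega) :=
    fun i => by simp [x]
  let C : Digraph V := ⟨fun u v => ∃ i, x i = u ∧ x (finRotate _ i) = v⟩
  have ha : x 0 = a := by simp [hx, hM]
  have hb : x (Fin.last _) = b := by simp [hx, hM]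
  -- The path is closed up by the arc `b a`, which need not lie in `D`; reversing it gives the arc
  -- `a b` of `D`.
  refine ⟨C.reverseArc b a, ⟨C, b, a, by simpa using hcard, ⟨_, x, by omega, fun u v => Iff.rfl⟩,
    ⟨Fin.last _, hb, by rw [finRotate_last, ha]⟩, rfl⟩, ?_⟩
  rintro u v (⟨⟨i, rfl, rfl⟩, hne⟩ | ⟨rfl, rfl⟩)
  · by_cases hi : i = Fin.last _
    · subst hi
      rw [finRotate_last] at hne
      exact absurd ⟨hb, ha⟩ hne
    · have hi' : i.1 < L.length + 1 := Fin.val_lt_last hi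
      have : finRotate _ i = ⟨i.1 + 1, by omega⟩ := finRotate_of_lt (k := i.1) hi'
      rw [this, hx, hx]
      exact List.isChain_iff_getElem.1 hc i.1 (by simp [hM]; omega)
  · exact hab

/-- The degree hypotheses: minimum in-degree at least three, and the condition on pairs of
non-adjacent vertices with a common in-neighbour. -/
structure DominatedPairCondition [Fintype V] (D : Digraph V) : Prop where
  loopless : D.Loopless
  card : 4 ≤ Fintype.card V
  inDeg : ∀ v, 3 ≤ D.inDeg v
  le_deg : ∀ {x y}, D.NonAdjacent x y → D.HasCommonInNeighbour x y →
    Fintype.card V ≤ D.deg x + 1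
  le_deg_add : ∀ {x y}, D.NonAdjacent x y → D.HasCommonInNeighbour x y →
    2 * Fintype.card V ≤ D.deg x + D.deg y + 1

/-- The form in which in-degree at least three is used: two prescribed vertices can be avoided. -/
theorem DominatedPairCondition.exists_inNeighbour [Fintype V] (hD : D.DominatedPairCondition)
    (v a b : V) : ∃ t, D.Adj t v ∧ t ≠ a ∧ t ≠ b := by
  classical
  by_contra! h
  have h1 : {y | D.Adj y v} ⊆ (({a, b} : Finset V) : Set V) := fun y hy => by
    by_cases hya : y = a
    · simp [hya]
    · simp [h y hy hya]
  have h2 := Set.ncard_le_ncard h1 (Finset.finite_toSet _)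
  rw [Set.ncard_coe_finset] at h2
  have := hD.inDeg v
  have h3 : ({a, b} : Finset V).card ≤ 2 := Finset.card_le_two
  unfold Digraph.inDeg at this
  omega

/-- No two consecutive vertices of a cycle through all vertices but `v` are out-neighbours
of `v`. -/
theorem BypassFree.not_adj_adj (hB : D.BypassFree) {v x y : V} {A B : List V}
    (hC : (A ++ x :: y :: B).IsClosedChain D.Adj) (hs : Spans (v :: (A ++ x :: y :: B)))
    (hx : D.Adj v x) : ¬ D.Adj v y := by
  classical
  intro hy
  have h1 : (y :: (B ++ A ++ [x])).IsClosedChain D.Adj := by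
    have := List.IsClosedChain.append_comm (A := A ++ [x]) (B := y :: B) (by simpa using hC)
    simpa using this
  refine hB v x (y :: (B ++ A)) ?_ (hs.perm (List.perm_of_forall_count fun a => ?_)) hx
  · simpa [hy] using h1.isChain
  · simp only [List.count_append, List.count_cons, List.count_nil]; omega

/-- No two consecutive vertices of a cycle through all vertices but `v` are in-neighbours
of `v`. -/
theorem BypassFree.not_adj_adj' (hB : D.BypassFree) {v x y : V} {A B : List V}
    (hC : (A ++ x :: y :: B).IsClosedChain D.Adj) (hs : Spans (v :: (A ++ x :: y :: B)))
    (hx : D.Adj x v) : ¬ D.Adj y v := by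
  classical
  intro hy
  have h1 : (y :: (B ++ A ++ [x])).IsClosedChain D.Adj := by
    have := List.IsClosedChain.append_comm (A := A ++ [x]) (B := y :: B) (by simpa using hC)
    simpa using this
  refine hB y v (B ++ A ++ [x]) ?_ (hs.perm (List.perm_of_forall_count fun a => ?_)) hy
  · rw [← List.cons_append, List.isChain_append]
    refine ⟨h1.isChain, by simp, ?_⟩
    rw [← List.cons_append, List.getLast?_concat]
    simpa using hx
  · simp only [List.count_append, List.count_cons, List.count_nil]; omega

/-- The out-neighbours of `v` are pairwise non-consecutive on a cycle of length `n - 1`, so they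
fill at most half of it, and strictly less if two consecutive vertices are both missed. -/
theorem BypassFree.two_mul_outDeg_le [Fintype V] (hB : D.BypassFree) (hl : D.Loopless)
    {v s t : V} {W : List V} (hC : (s :: t :: W).IsClosedChain D.Adj)
    (hs : Spans (v :: s :: t :: W)) :
    2 * D.outDeg v + 1 ≤ Fintype.card V ∧
      (¬ D.Adj v s → ¬ D.Adj v t → 2 * D.outDeg v + 2 ≤ Fintype.card V) := by
  classical
  rw [Spans.outDeg_eq hl hs, ← hs.length_eq, List.length_cons]
  have := List.two_mul_countP_le (P := fun a => D.Adj v a) (s := s) (t := t) (W := W) ?_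
    (fun h => hB.not_adj_adj (A := []) hC hs h.1 h.2)
  · exact ⟨by omega, fun h1 h2 => by have := this.2 h1 h2; omega⟩
  rintro a b ⟨A, B, h⟩ ⟨ha, hb⟩
  have hp : A ++ a :: b :: B = t :: (W ++ [s]) := by simp [← h]
  refine hB.not_adj_adj (A := A) (B := B) (v := v) ?_ ?_ ha hb
  · rw [hp]
    simpa using List.IsClosedChain.append_comm (A := [s]) (B := t :: W) hC
  · rw [hp]
    refine hs.perm (List.perm_of_forall_count fun a => ?_)
    simp only [List.count_append, List.count_cons, List.count_nil]; omega

theorem BypassFree.two_mul_inDeg_le [Fintype V] (hB : D.BypassFree) (hl : D.Loopless)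
    {v s t : V} {W : List V} (hC : (s :: t :: W).IsClosedChain D.Adj)
    (hs : Spans (v :: s :: t :: W)) :
    2 * D.inDeg v + 1 ≤ Fintype.card V ∧
      (¬ D.Adj s v → ¬ D.Adj t v → 2 * D.inDeg v + 2 ≤ Fintype.card V) := by
  classical
  rw [Spans.inDeg_eq hl hs, ← hs.length_eq, List.length_cons]
  have := List.two_mul_countP_le (P := fun a => D.Adj a v) (s := s) (t := t) (W := W) ?_
    (fun h => hB.not_adj_adj' (A := []) hC hs h.1 h.2)
  · exact ⟨by omega, fun h1 h2 => by have := this.2 h1 h2; omega⟩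
  rintro a b ⟨A, B, h⟩ ⟨ha, hb⟩
  have hp : A ++ a :: b :: B = t :: (W ++ [s]) := by simp [← h]
  refine hB.not_adj_adj' (A := A) (B := B) (v := v) ?_ ?_ ha hb
  · rw [hp]
    simpa using List.IsClosedChain.append_comm (A := [s]) (B := t :: W) hC
  · rw [hp]
    refine hs.perm (List.perm_of_forall_count fun a => ?_)
    simp only [List.count_append, List.count_cons, List.count_nil]; omega

theorem BypassFree.deg_lt [Fintype V] (hB : D.BypassFree) (hl : D.Loopless)
    {v s t : V} {W : List V} (hC : (s :: t :: W).IsClosedChain D.Adj)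
    (hs : Spans (v :: s :: t :: W)) : D.deg v + 1 ≤ Fintype.card V := by
  have h1 := (hB.two_mul_outDeg_le hl hC hs).1
  have h2 := (hB.two_mul_inDeg_le hl hC hs).1
  unfold deg
  omega

/-- If a vertex `v` outside a cycle through all other vertices is dominated by a vertex of the
cycle, then `v` dominates the successor of that vertex. -/
theorem BypassFree.adj_of_adj [Fintype V] (hB : D.BypassFree) (hD : D.DominatedPairCondition)
    {v x s : V} {A B : List V} (hC : (A ++ x :: s :: B).IsClosedChain D.Adj)
    (hs : Spans (v :: (A ++ x :: s :: B))) (hx : D.Adj x v) : D.Adj v s := by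
  classical
  obtain ⟨t, W, hW⟩ : ∃ t W, B ++ A = t :: W := by
    rcases h : B ++ A with _ | ⟨t, W⟩
    · have h1 := hs.length_eq
      have h2 := hD.card
      have h3 := congrArg List.length h
      simp only [List.length_append, List.length_cons, List.length_nil] at h1 h3
      omega
    · exact ⟨t, W, rfl⟩
  have hC1 : (x :: s :: t :: W).IsClosedChain D.Adj := by
    have := hC.append_comm
    simpa [hW] using this
  have hs1 : Spans (v :: x :: s :: t :: W) := by
    refine hs.perm ?_
    rw [← hW]
    refine List.perm_of_forall_count fun a => ?_
    simp only [List.count_append, List.count_cons]; omega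
  have hC2 : (s :: t :: (W ++ [x])).IsClosedChain D.Adj := by
    simpa using List.IsClosedChain.append_comm (A := [x]) (B := s :: t :: W) hC1
  have hs2 : Spans (v :: s :: t :: (W ++ [x])) :=
    hs1.perm (List.perm_of_forall_count fun a => by
      simp only [List.count_append, List.count_cons, List.count_nil]; omega)
  have hxs : D.Adj x s := by
    have := List.isClosedChain_cons.1 hC1
    simp at this
    exact this.1
  by_contra hvs
  have hsv : ¬ D.Adj s v := hB.not_adj_adj' (A := []) hC1 hs1 hx
  have hne : v ≠ s := by
    have := hs1.1
    simp at this
    tauto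
  have hna : D.NonAdjacent v s := ⟨hne, hvs, hsv⟩
  have hcom : D.HasCommonInNeighbour v s := ⟨x, hx, hxs⟩
  have hv := hD.le_deg hna hcom
  have hsum := hD.le_deg_add hna hcom
  have hout := hB.two_mul_outDeg_le hD.loopless hC2 hs2
  have hin := hB.two_mul_inDeg_le hD.loopless hC2 hs2
  -- If `v` dominates `t`, then `v` can replace `s` on the cycle, so both degrees are at most `n -
  -- 1` and the sum is too small. If not, `v` dominates neither of the consecutive `s`, `t`, which
  -- forces `d(v) ≤ n - 2`.
  by_cases hvt : D.Adj v t
  · have hC3 : (x :: v :: t :: W).IsClosedChain D.Adj :=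
      List.IsClosedChain.replace (A := []) (M := [s]) (M' := [v]) hC1 (by simp [hx, hvt])
    have hs3 : Spans (s :: x :: v :: t :: W) :=
      hs1.perm (List.perm_of_forall_count fun a => by
        simp only [List.count_cons]; omega)
    have h1 := hB.deg_lt hD.loopless hC2 hs2
    have h2 := hB.deg_lt hD.loopless hC3 hs3
    omega
  · have := hout.2 hvs hvt
    unfold deg at hv
    omega

/-- A vertex whose removal leaves a Hamiltonian digraph is adjacent to every vertex with which it
has a common in-neighbour. -/
theorem BypassFree.adj_or_adj [Fintype V] (hB : D.BypassFree) (hD : D.DominatedPairCondition)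
    {v c : V} {C : List V} (hC : C.IsClosedChain D.Adj) (hs : Spans (v :: C)) (hc : c ≠ v)
    (hcom : D.HasCommonInNeighbour v c) : D.Adj v c ∨ D.Adj c v := by
  classical
  have hcC : c ∈ C := by
    have := hs.2 c
    simpa [hc] using this
  obtain ⟨A, B, rfl⟩ := List.append_of_mem hcC
  obtain ⟨Z, x, hZ⟩ : ∃ Z x, B ++ A = Z ++ [x] := by
    rcases List.eq_nil_or_concat (B ++ A) with h | ⟨Z, x, h⟩
    · have h1 := hs.length_eq
      have h2 := hD.card
      have h3 := congrArg List.length h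
      simp only [List.length_append, List.length_cons, List.length_nil] at h1 h3
      omega
    · exact ⟨Z, x, by simpa using h⟩
  have hC1 : (x :: c :: Z).IsClosedChain D.Adj := by
    have h1 := hC.append_comm
    rw [List.cons_append, hZ, ← List.cons_append] at h1
    simpa using h1.append_comm
  have hs1 : Spans (v :: x :: c :: Z) := by
    refine hs.perm (List.perm_of_forall_count fun a => ?_)
    have := congrArg (List.count a) hZ
    simp only [List.count_append, List.count_cons, List.count_nil] at this ⊢; omega
  have h1 := hB.two_mul_outDeg_le hD.loopless hC1 hs1
  have h2 := hB.two_mul_inDeg_le hD.loopless hC1 hs1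
  by_contra! h
  have hdeg := hD.le_deg ⟨hc.symm, h⟩ hcom
  -- Otherwise the consecutive `x`, `c` both fail to dominate `v`, and the sharper in-degree bound
  -- contradicts `d(v) ≥ n - 1`.
  have hxv : D.Adj x v := by
    by_contra hxv
    have := h2.2 hxv h.2
    unfold deg at hdeg
    omega
  exact h.1 (hB.adj_of_adj (A := []) hD hC1 hs1 hxv)

/-! ### Reinserting a vertex of a Hamiltonian cycle. -/

theorem BypassFree.not_adj_of_isClosedChain (hB : D.BypassFree) {x y : V} {W : List V}
    (hC : (x :: y :: W).IsClosedChain D.Adj) (hs : Spans (x :: y :: W)) : ¬ D.Adj y x := by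
  classical
  have h1 : (y :: (W ++ [x])).IsClosedChain D.Adj := by
    simpa using List.IsClosedChain.append_comm (A := [x]) (B := y :: W) hC
  refine hB y x W h1.isChain (hs.perm (List.perm_of_forall_count fun a => ?_))
  simp only [List.count_append, List.count_cons, List.count_nil]; omega

/-- Each vertex of `A` or `B` contributes at most one to `d(u)`. Non-insertability and the two end
conditions bound the contribution of `Q` by its length minus one. -/
theorem deg_add_one_le_of_not_insertable [Fintype V] (hl : D.Loopless) {u : V} {A Q B : List V}
    (hs : Spans (u :: (A ++ (Q ++ B)))) (hQ : Q ≠ []) (hins : ¬ Q.Insertable D.Adj u)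
    (hlast : ¬ D.Adj (Q.getLast hQ) u) (hA : ∀ a ∈ A, ¬ D.Adj a u) (hB : ∀ b ∈ B, ¬ D.Adj u b)
    (hhead : ¬ D.Adj u (Q.head hQ)) : D.deg u + 2 ≤ Fintype.card V := by
  classical
  have hout := Spans.outDeg_eq hl hs
  have hin := Spans.inDeg_eq hl hs
  obtain ⟨e, f, he, hf, h1, h2, hc⟩ := List.exists_countP_add_countP_le
    (P := fun a => D.Adj a u) (Q := fun a => D.Adj u a) hQ
    fun a b hab h => hins ⟨a, b, hab, h⟩
  have h3 : e ≠ 1 := fun h => hlast (h1 h)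
  have h4 : f ≠ 1 := fun h => hhead (h2 h)
  have h5 : A.countP (fun a => D.Adj a u) = 0 := by simpa [List.countP_eq_zero] using hA
  have h6 : B.countP (fun a => D.Adj u a) = 0 := by simpa [List.countP_eq_zero] using hB
  have h7 := List.countP_le_length (p := fun a => decide (D.Adj u a)) (l := A)
  have h8 := List.countP_le_length (p := fun a => decide (D.Adj a u)) (l := B)
  rw [List.countP_append, List.countP_append] at hin hout
  have := hs.length_eq
  simp only [List.length_append, List.length_cons] at this
  unfold deg
  omega

/-- A vertex `u` of a Hamiltonian cycle can be inserted into the rest of the cycle, or `u` has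
the predecessor of its predecessor as an in-neighbour. -/
theorem BypassFree.insertable_or [Fintype V] (hB : D.BypassFree) (hD : D.DominatedPairCondition)
    {u : V} {L : List V} (hC : (u :: L).IsClosedChain D.Adj) (hs : Spans (u :: L)) :
    L.Insertable D.Adj u ∨ ∃ L' p q, L = L' ++ [p, q] ∧ D.Adj p u := by
  classical
  by_contra! h
  obtain ⟨hins, hpen⟩ := h
  obtain ⟨c₀, c₁, Y, q, rfl⟩ : ∃ c₀ c₁ Y q, L = c₀ :: c₁ :: (Y ++ [q]) := by
    have h1 := hs.length_eq
    have h2 := hD.card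
    match L, h1 with
    | c₀ :: c₁ :: c₂ :: K, _ =>
      exact ⟨c₀, c₁, (c₂ :: K).dropLast, (c₂ :: K).getLast (by simp),
        by rw [List.dropLast_append_getLast]⟩
    | [], h1 => simp at h1; omega
    | [_], h1 => simp at h1; omega
    | [_, _], h1 => simp at h1; omega
  have hp : ¬ D.Adj ((c₁ :: Y).getLast (by simp)) u := by
    refine hpen (c₀ :: (c₁ :: Y).dropLast) _ q ?_
    have := congrArg (fun K => c₀ :: (K ++ [q]))
      (List.dropLast_append_getLast (l := c₁ :: Y) (by simp))
    simpa using this.symm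
  have hchain := hC.isChain
  have huc₀ : D.Adj u c₀ := by simp at hchain; exact hchain.1
  have hc₀c₁ : D.Adj c₀ c₁ := by simp at hchain; exact hchain.2.1
  have hc₀u : ¬ D.Adj c₀ u := hB.not_adj_of_isClosedChain hC hs
  have hc₁c₀ : ¬ D.Adj c₁ c₀ := by
    refine hB.not_adj_of_isClosedChain (W := Y ++ [q] ++ [u]) ?_ (hs.perm ?_)
    · simpa using List.IsClosedChain.append_comm (A := [u]) hC
    · refine List.perm_of_forall_count fun a => ?_
      simp only [List.count_append, List.count_cons, List.count_nil]; omega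
  have huq : ¬ D.Adj u q := by
    refine hB.not_adj_of_isClosedChain (W := c₀ :: c₁ :: Y) ?_ (hs.perm ?_)
    · simpa using List.IsClosedChain.append_comm (A := u :: c₀ :: c₁ :: Y) (B := [q])
        (by simpa using hC)
    · refine List.perm_of_forall_count fun a => ?_
      simp only [List.count_append, List.count_cons, List.count_nil]; omega
  have hdeg : Fintype.card V ≤ D.deg u + 1 := by
    obtain ⟨j, hj, hjq, hju⟩ := hD.exists_inNeighbour u q u
    have hj' : j ∈ c₀ :: c₁ :: Y := by
      have := hs.2 j
      simp only [List.mem_cons, List.mem_append, List.not_mem_nil, hjq, hju] at this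
      simpa using this
    obtain ⟨a, b, hab, hau, hbu⟩ := List.exists_consecutive_of_mem_of_not_getLast
      (P := fun x => D.Adj x u) (L := c₀ :: c₁ :: Y) (by simp) ⟨j, hj', hj⟩
      (by simpa using hp)
    have hab' : [a, b] <:+: c₀ :: c₁ :: (Y ++ [q]) := hab.trans ⟨[], [q], by simp⟩
    have hub : ¬ D.Adj u b := fun h => hins ⟨a, b, hab', hau, h⟩
    refine hD.le_deg (y := b) ⟨?_, hub, hbu⟩ ⟨a, hau, ?_⟩
    · rintro rfl
      exact (List.nodup_cons.1 hs.1).1 (hab'.subset (by simp))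
    · have := hchain.tail.infix hab'
      simpa using this
  obtain ⟨c₂, Z, rfl⟩ : ∃ c₂ Z, Y = c₂ :: Z := by
    rcases Y with _ | ⟨c₂, Z⟩
    · obtain ⟨j, hj, hjq, hju⟩ := hD.exists_inNeighbour u q u
      have := hs.2 j
      simp only [List.nil_append, List.mem_cons, List.not_mem_nil, hjq, hju] at this
      simp only [List.getLast_singleton] at hp
      rcases this with h | h | h | h | h
      · exact absurd h id
      · exact absurd (h ▸ hj) hc₀u
      · exact absurd (h ▸ hj) hp
      · exact absurd h id
      · exact absurd h id
    · exact ⟨c₂, Z, rfl⟩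
  -- Otherwise the count gives `d(u) ≤ n - 2`. Now `c₀` can be bypassed, leaving a cycle that misses
  -- only `c₀`.
  have huc₁ : D.Adj u c₁ := by
    by_contra h
    have := deg_add_one_le_of_not_insertable (A := [c₀]) (Q := c₁ :: c₂ :: Z) (B := [q])
      hD.loopless (by simpa using hs) (by simp)
      (fun ⟨a, b, hab, h⟩ => hins ⟨a, b, hab.trans ⟨[c₀], [q], by simp⟩, h⟩) hp
      (by simpa using hc₀u) (by simpa using huq) (by simpa using h)
    omega
  have hC₀ : (u :: c₁ :: c₂ :: (Z ++ [q])).IsClosedChain D.Adj :=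
    List.IsClosedChain.replace (A := []) (M := [c₀]) (M' := []) hC (by simpa using huc₁)
  have hs₀ : Spans (c₀ :: u :: c₁ :: c₂ :: (Z ++ [q])) :=
    hs.perm (List.Perm.swap _ _ _)
  -- an in-neighbour of `c₀` other than `u` and `c₁` is followed by an out-neighbour of `c₀`
  have hsucc : ∀ A t B, c₂ :: (Z ++ [q]) = A ++ t :: B → D.Adj t c₀ →
      ∃ s B', B = s :: B' ∧ D.Adj c₀ s := by
    intro A t B hAB ht
    -- If `t` is the last vertex, its successor is `u`, and `c₀` would dominate `u`.
    rcases B with _ | ⟨s, B'⟩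
    · refine absurd (hB.adj_of_adj hD (A := []) (x := t) (s := u) (B := c₁ :: A) (v := c₀)
        ?_ (hs₀.perm ?_) ht) hc₀u
      · simpa using List.IsClosedChain.append_comm (A := u :: c₁ :: A) (B := [t])
          (by simpa [hAB] using hC₀)
      · rw [hAB]
        refine List.perm_of_forall_count fun a => ?_
        simp only [List.count_append, List.count_cons, List.count_nil]; omega
    · refine ⟨s, B', rfl, hB.adj_of_adj hD (A := u :: c₁ :: A) (x := t) (B := B') ?_ ?_ ht⟩
      · simpa [hAB] using hC₀
      · simpa [hAB] using hs₀
  have hmem : ∀ t, D.Adj t c₀ → t ≠ u → t ∈ c₂ :: (Z ++ [q]) := by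
    intro t ht htu
    have := hs₀.2 t
    rcases List.mem_cons.1 this with h | h
    · exact absurd (h ▸ ht) (hD.loopless _)
    rcases List.mem_cons.1 h with h | h
    · exact absurd h htu
    rcases List.mem_cons.1 h with h | h
    · exact absurd (h ▸ ht) hc₁c₀
    · exact h
  -- Reinserting `c₀` between `t` and `s` gives a Hamiltonian cycle through the arc `u c₁`, whose
  -- opposite is therefore excluded.
  have hc₁u : ¬ D.Adj c₁ u := by
    obtain ⟨t, ht, htu, -⟩ := hD.exists_inNeighbour c₀ u u
    obtain ⟨A, B, hAB⟩ := List.append_of_mem (hmem t ht htu)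
    obtain ⟨s, B, rfl, hs'⟩ := hsucc A t B hAB ht
    refine hB.not_adj_of_isClosedChain (W := A ++ t :: c₀ :: s :: B) ?_ (hs₀.perm ?_)
    · refine List.IsClosedChain.insert (A := u :: c₁ :: A) ?_ ht hs'
      simpa [hAB] using hC₀
    · rw [hAB]
      refine List.perm_of_forall_count fun a => ?_
      simp only [List.count_append, List.count_cons]; omega
  have huc₂ : D.Adj u c₂ := by
    by_contra h
    have := deg_add_one_le_of_not_insertable (A := [c₀, c₁]) (Q := c₂ :: Z) (B := [q])
      hD.loopless (by simpa using hs) (by simp)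
      (fun ⟨a, b, hab, h⟩ => hins ⟨a, b, hab.trans ⟨[c₀, c₁], [q], by simp⟩, h⟩)
      (by simpa using hp)
      (by simpa using ⟨hc₀u, hc₁u⟩) (by simpa using huq) (by simpa using h)
    omega
  have hc₀c₂ : ¬ D.Adj c₀ c₂ := hB.not_adj_adj (A := [u]) hC₀ hs₀ hc₀c₁
  have hc₂c₀ : D.Adj c₂ c₀ := by
    refine (hB.adj_or_adj hD hC₀ hs₀ (c := c₂) ?_ ⟨u, huc₀, huc₂⟩).resolve_left hc₀c₂
    rintro rfl
    have := hs₀.1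
    simp at this
  obtain ⟨c₃, M, hM⟩ : ∃ c₃ M, Z ++ [q] = c₃ :: M := by cases Z <;> simp
  rw [List.cons_append] at hchain
  rw [hM] at hC₀ hs₀ hsucc hmem hchain
  have hc₁c₂ : D.Adj c₁ c₂ := by simp at hchain; exact hchain.2.2.1
  have hc₀c₃ : D.Adj c₀ c₃ := hB.adj_of_adj hD (A := [u, c₁]) hC₀ hs₀ hc₂c₀
  have hC₂ : (u :: c₂ :: c₃ :: M).IsClosedChain D.Adj :=
    List.IsClosedChain.replace (A := []) (M := [c₁]) (M' := []) hC₀ (by simpa using huc₂)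
  have hc₁c₃ : D.Adj c₁ c₃ := by
    refine hB.adj_of_adj hD (v := c₁) (A := [u, c₂]) (x := c₀) (s := c₃) (B := M)
      (List.IsClosedChain.insert (A := [u]) hC₂ hc₂c₀ hc₀c₃) (hs₀.perm ?_) hc₀c₁
    refine List.perm_of_forall_count fun a => ?_
    simp only [List.count_append, List.count_cons, List.count_nil]; omega
  -- A third in-neighbour of `c₀` allows `c₀` to be placed after `t`, away from `c₂ c₃`. The
  -- resulting cycle misses only `c₁`, which dominates the consecutive `c₂` and `c₃`.
  obtain ⟨t, ht, htu, htc₂⟩ := hD.exists_inNeighbour c₀ u c₂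
  have htm : t ∈ c₃ :: M := by simpa [htc₂] using hmem t ht htu
  obtain ⟨A, B, hAB⟩ := List.append_of_mem htm
  obtain ⟨s, B, rfl, hs'⟩ := hsucc (c₂ :: A) t B (by simp [hAB]) ht
  have hC₃ : (u :: c₂ :: (A ++ t :: c₀ :: s :: B)).IsClosedChain D.Adj := by
    refine List.IsClosedChain.insert (A := u :: c₂ :: A) ?_ ht hs'
    simpa [hAB] using hC₂
  obtain ⟨X, hX⟩ : ∃ X, A ++ t :: c₀ :: s :: B = c₃ :: X := by
    cases A <;> simp at hAB ⊢ <;> simp [hAB]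
  have hs₃ : Spans (c₁ :: u :: c₂ :: (A ++ t :: c₀ :: s :: B)) := by
    refine hs₀.perm ?_
    rw [hAB]
    refine List.perm_of_forall_count fun a => ?_
    simp only [List.count_append, List.count_cons]; omega
  rw [hX] at hC₃ hs₃
  exact hB.not_adj_adj (A := [u]) hC₃ hs₃ hc₁c₂ hc₁c₃

end Digraph

/-! ### Shortest chords of Hamiltonian cycles. -/

theorem List.mem_or_mem_or_pair_infix {V : Type*} {A Q B : List V} {x y : V}
    (h : [x, y] <:+: A ++ (Q ++ B)) : x ∈ A ∨ y ∈ B ∨ [x, y] <:+: Q := by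
  rcases pair_infix_append h with h | h | ⟨A', B', h, -⟩
  · exact .inl (h.subset (by simp))
  · rcases pair_infix_append h with h | h | ⟨A', B', -, h⟩
    · exact .inr (.inr h)
    · exact .inr (.inl (h.subset (by simp)))
    · exact .inr (.inl (by simp [h]))
  · exact .inl (by simp [h])

namespace Digraph

variable {V : Type*} {D : Digraph V}

/-- `i :: (I ++ k :: W)` is a Hamiltonian cycle with the chord `k i`, which skips `W`. -/
structure IsChord (D : Digraph V) (i : V) (I : List V) (k : V) (W : List V) : Prop where
  closed : (i :: (I ++ k :: W)).IsClosedChain D.Adj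
  spans : Spans (i :: (I ++ k :: W))
  ne_nil : W ≠ []
  adj : D.Adj k i

theorem IsChord.of_append_eq {i' k' : V} {I' W' A B C : List V}
    (hC : C.IsClosedChain D.Adj) (hs : Spans C) (hAB : C = A ++ B)
    (hBA : B ++ A = i' :: (I' ++ k' :: W')) (hW : W' ≠ []) (h : D.Adj k' i') :
    D.IsChord i' I' k' W' where
  closed := hBA ▸ (hAB ▸ hC).append_comm
  spans := hBA ▸ (hAB ▸ hs).perm List.perm_append_comm
  ne_nil := hW
  adj := h

/-- `i :: (I ++ k :: W)` is a Hamiltonian cycle with a chord `k i` skipping as many vertices as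
possible. -/
structure IsShortestChord (D : Digraph V) (i : V) (I : List V) (k : V) (W : List V) : Prop
    extends D.IsChord i I k W where
  length_le : ∀ {i' I' k' W'}, D.IsChord i' I' k' W' → I.length ≤ I'.length

/-- An arc into `v` from a later vertex of `I`, or from `v` to an earlier one, is a shorter chord.
So if all of `I` were insertable, it could be inserted into the path from `k` through `W` to `i`,
and the arc `k i` would give a bypass. -/
theorem IsShortestChord.exists_not_insertable [Fintype V] {i k : V} {I W : List V}
    (hB : D.BypassFree) (h : D.IsShortestChord i I k W) :
    ∃ I₁ v I₂, I = I₁ ++ v :: I₂ ∧ ¬ (I₂ ++ k :: (W ++ i :: I₁)).Insertable D.Adj v := by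
  by_contra! hall
  have hins : ∀ v ∈ I, (k :: (W ++ [i])).Insertable D.Adj v := by
    intro v hv
    obtain ⟨I₁, I₂, rfl⟩ := List.append_of_mem hv
    obtain ⟨x, y, hxy, hxv, hvy⟩ := hall I₁ v I₂ rfl
    rcases List.mem_or_mem_or_pair_infix (A := I₂) (Q := k :: (W ++ [i])) (B := I₁)
      (by simpa using hxy) with hx | hy | hQ
    · obtain ⟨J, K, rfl⟩ := List.append_of_mem hx
      have := h.length_le (IsChord.of_append_eq (i' := v) (I' := J) (k' := x)
        (W' := K ++ k :: W ++ i :: I₁) (A := i :: I₁) (B := v :: (J ++ x :: (K ++ k :: W)))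
        h.closed h.spans (by simp) (by simp) (by simp) hxv)
      simp at this
      omega
    · obtain ⟨J, K, rfl⟩ := List.append_of_mem hy
      have := h.length_le (IsChord.of_append_eq (i' := y) (I' := K) (k' := v)
        (W' := I₂ ++ k :: W ++ i :: J) (A := i :: J) (B := y :: (K ++ v :: (I₂ ++ k :: W)))
        h.closed h.spans (by simp) (by simp) (by simp) hvy)
      simp at this
      omega
    · exact ⟨x, y, hQ, hxv, hvy⟩
  have hcl : (I ++ k :: (W ++ [i])).IsClosedChain D.Adj := by
    simpa using List.IsClosedChain.append_comm (A := [i]) (B := I ++ k :: W) h.closed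
  have hch := List.isChain_append.1 hcl.isChain
  obtain ⟨Q', hQ', hperm, hhead, hlast⟩ :=
    List.exists_multi_insertion I.length I le_rfl _ hch.1 hch.2.1 hins
  have hsp : Spans Q' := by
    refine h.spans.perm (hperm.trans ?_)
    classical
    refine List.perm_of_forall_count fun a => ?_
    simp only [List.count_append, List.count_cons, List.count_nil]; omega
  obtain ⟨X, rfl⟩ : ∃ X, Q' = k :: X := by
    rcases Q' with _ | ⟨a, X⟩
    · simp at hhead
    · exact ⟨X, by simpa using hhead⟩
  rcases List.eq_nil_or_concat X with rfl | ⟨Y, b, rfl⟩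
  · have := hperm.length_eq
    simp at this
  · rw [List.concat_eq_append] at *
    have hb : b = i := by
      rw [← List.cons_append, ← List.cons_append] at hlast
      rw [List.getLast?_concat, List.getLast?_concat] at hlast
      simpa using hlast
    subst hb
    exact hB k b Y hQ' hsp h.adj

/-- A non-insertable `v` is dominated by the vertex `p` two places before it. If its predecessor `y`
lay in `I`, the arc `p v` would close a cycle missing only `y`, and another in-neighbour `t` of `y`
would give a shorter chord wherever it lies. Hence `v` directly follows `i`. -/
theorem IsShortestChord.exists_cons [Fintype V] {i k : V} {I W : List V}
    (hB : D.BypassFree) (hD : D.DominatedPairCondition) (h : D.IsShortestChord i I k W) :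
    ∃ v I₂ W' p, I = v :: I₂ ∧ W = W' ++ [p] ∧ D.Adj p v ∧
      ¬ (I₂ ++ k :: (W ++ [i])).Insertable D.Adj v := by
  classical
  obtain ⟨I₁, v, I₂, rfl, hins⟩ := h.exists_not_insertable hB
  have hcl : (v :: (I₂ ++ k :: (W ++ i :: I₁))).IsClosedChain D.Adj := by
    simpa using List.IsClosedChain.append_comm (A := i :: I₁) (B := v :: (I₂ ++ k :: W))
      (by simpa using h.closed)
  have hsp : Spans (v :: (I₂ ++ k :: (W ++ i :: I₁))) := by
    refine h.spans.perm (List.perm_of_forall_count fun a => ?_)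
    simp only [List.count_append, List.count_cons]; omega
  obtain ⟨L', p, q, hL, hpv⟩ := (hB.insertable_or hD hcl hsp).resolve_left hins
  obtain ⟨W', w, hW⟩ : ∃ W' w, W = W' ++ [w] := by
    rcases List.eq_nil_or_concat W with hW | ⟨W', w, hW⟩
    · exact absurd hW h.ne_nil
    · exact ⟨W', w, by simpa using hW⟩
  rcases List.eq_nil_or_concat I₁ with rfl | ⟨J, y, rfl⟩
  · subst hW
    refine ⟨v, I₂, W', w, rfl, rfl, ?_, hins⟩
    have : L' ++ [p] ++ [q] = (I₂ ++ k :: W' ++ [w]) ++ [i] := by simpa using hL.symm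
    have := (List.append_inj' this rfl).1
    have := (List.append_inj' this rfl).2
    simp only [List.cons.injEq, and_true] at this
    exact this ▸ hpv
  exfalso
  rw [List.concat_eq_append] at *
  have hL₁ : (I₂ ++ k :: (W ++ i :: J)) ++ [y] = (L' ++ [p]) ++ [q] := by simpa using hL
  obtain ⟨hL', hyq⟩ := List.append_inj' hL₁ rfl
  simp only [List.cons.injEq, and_true] at hyq
  subst hyq
  have hcl' : (v :: (I₂ ++ k :: (W ++ i :: J))).IsClosedChain D.Adj := by
    have hch := hcl.isChain.prefix (l₁ := v :: (I₂ ++ k :: (W ++ i :: J))) ⟨[y], by simp⟩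
    rw [hL'] at hch ⊢
    exact List.isClosedChain_of_isChain hch hpv
  have hsp' : Spans (y :: (v :: (I₂ ++ k :: (W ++ i :: J)))) := by
    refine hsp.perm (List.perm_of_forall_count fun a => ?_)
    simp only [List.count_append, List.count_cons, List.count_nil]; omega
  obtain ⟨t, ht, htp, hty⟩ := hD.exists_inNeighbour y p y
  have htm : t ∈ (v :: I₂) ∨ t ∈ k :: W ∨ t ∈ i :: J := by
    have := hsp'.2 t
    simp only [List.mem_cons, List.mem_append, hty, false_or] at this ⊢
    tauto
  rcases htm with htm | htm | htm
  · obtain ⟨A, B, hAB⟩ := List.append_of_mem htm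
    have := h.length_le (IsChord.of_append_eq (i' := y) (I' := A) (k' := t)
        (W' := B ++ k :: W ++ i :: J) (A := i :: J) (B := y :: (A ++ t :: (B ++ k :: W)))
        h.closed h.spans (by simp [hAB]) (by simp) (by simp) ht)
    have h2 := congrArg List.length hAB
    simp only [List.length_append, List.length_cons, List.length_nil] at this h2
    omega
  -- Here `y` is moved out of `I` to the place after `t`, which shortens the segment cut off by the
  -- same chord `k i`.
  · obtain ⟨A, B, hAB⟩ := List.append_of_mem htm
    obtain ⟨s, B', hB'⟩ : ∃ s B', B ++ i :: J = s :: B' := by cases B <;> simp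
    have e : v :: (I₂ ++ k :: (W ++ i :: J)) = (v :: I₂ ++ A) ++ t :: s :: B' := by
      rw [← hB']
      have := congrArg (fun K => v :: (I₂ ++ (K ++ i :: J))) hAB
      simpa using this
    rw [e] at hcl' hsp'
    have hys := hB.adj_of_adj hD hcl' hsp' ht
    have hcl₂ := hcl'.insert ht hys
    obtain ⟨X, hX⟩ : ∃ X, A ++ t :: y :: B = k :: X := by
      cases A <;> simp at hAB ⊢ <;> simp [hAB]
    have hXne : X ≠ [] := by
      rintro rfl
      have := congrArg List.length hX
      simp at this
      omega
    have hcl₃ : (i :: ((J ++ v :: I₂) ++ k :: X)).IsClosedChain D.Adj := by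
      rw [← hX]
      have : ((v :: I₂ ++ A ++ t :: y :: B) ++ i :: J).IsClosedChain D.Adj := by
        have e' : v :: I₂ ++ A ++ t :: y :: B ++ i :: J = v :: I₂ ++ A ++ t :: y :: s :: B' := by
          rw [← hB']; simp
        rw [e']
        exact hcl₂
      simpa using this.append_comm
    have hsp₃ : Spans (i :: ((J ++ v :: I₂) ++ k :: X)) := by
      rw [← hX]
      refine h.spans.perm (List.perm_of_forall_count fun a => ?_)
      have := congrArg (List.count a) hAB
      simp only [List.count_append, List.count_cons, List.count_nil] at this ⊢; omega
    have := h.length_le ⟨hcl₃, hsp₃, hXne, h.adj⟩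
    simp at this
  · obtain ⟨A, B, hAB⟩ := List.append_of_mem htm
    rcases B with _ | ⟨s, B⟩
    · have h1 : (I₂ ++ k :: (W ++ A)) ++ [t] = L' ++ [p] := by
        rw [← hL', hAB]; simp
      have := (List.append_inj' h1 rfl).2
      simp only [List.cons.injEq, and_true] at this
      exact htp this
    · have e : v :: (I₂ ++ k :: (W ++ i :: J)) = (v :: I₂ ++ k :: W ++ A) ++ t :: s :: B := by
        rw [hAB]; simp
      have hys : D.Adj y s := by
        rw [e] at hcl' hsp'
        exact hB.adj_of_adj hD hcl' hsp' ht
      have e2 : i :: (J ++ [y] ++ v :: I₂ ++ k :: W) =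
          (A ++ [t]) ++ (s :: (B ++ y :: (v :: I₂ ++ k :: W))) := by
        have := congrArg (fun K => K ++ (y :: (v :: I₂ ++ k :: W))) hAB
        simpa using this
      have := h.length_le (IsChord.of_append_eq (i' := s) (I' := B) (k' := y)
        (W' := v :: I₂ ++ k :: W ++ A ++ [t])
        h.closed h.spans e2 (by simp) (by simp) hys)
      have h2 := congrArg List.length hAB
      simp only [List.length_append, List.length_cons, List.length_nil] at this h2
      omega

/-- In a bypass-free digraph satisfying the degree condition no Hamiltonian cycle has a shortest
chord. -/
theorem BypassFree.not_isShortestChord [Fintype V] (hB : D.BypassFree) (hD : D.DominatedPairCondition)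
    {i k : V} {I W : List V} : ¬ D.IsShortestChord i I k W := by
  classical
  intro h
  obtain ⟨v, I₂, W', p, rfl, rfl, hpv, hins⟩ := h.exists_cons hB hD
  have hcl₀ : (v :: (I₂ ++ k :: W' ++ [p])).IsClosedChain D.Adj := by
    refine List.isClosedChain_of_isChain ?_ hpv
    have := h.closed.isChain.tail
    simpa using this
  have hsp₀ : Spans (i :: v :: (I₂ ++ k :: W' ++ [p])) := by
    simpa using h.spans
  obtain ⟨w, W₀, hW⟩ : ∃ w W₀, W' ++ [p] = w :: W₀ := by cases W' <;> simp
  have hiw : D.Adj i w := by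
    refine hB.adj_of_adj hD (A := v :: I₂) (x := k) (B := W₀) ?_ ?_ h.adj
    · simpa [hW] using hcl₀
    · simpa [hW] using hsp₀
  have hiv : D.Adj i v := by
    have := h.closed.isChain
    simp at this
    exact this.1
  -- Moving `i` to the place after `k` makes `i v` a chord. Its segment has the same length as `v ::
  -- I₂`, so it is again shortest.
  have h₁ : D.IsShortestChord v (I₂ ++ [k]) i (W' ++ [p]) := by
    refine ⟨⟨?_, ?_, by simp, hiv⟩, fun hc => ?_⟩
    · rw [hW]
      have := List.IsClosedChain.insert (A := v :: I₂) (x := k) (y := w) (B := W₀) (v := i)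
        (by simpa [hW] using hcl₀) h.adj hiw
      simpa using this
    · refine h.spans.perm (List.perm_of_forall_count fun a => ?_)
      simp only [List.count_append, List.count_cons, List.count_nil]; omega
    · have := h.length_le hc
      simpa using this
  obtain ⟨v', I₂', W'', p', hI, hW'', hp'v', -⟩ := h₁.exists_cons hB hD
  have hpp : p = p' := by simpa using (List.append_inj' hW'' rfl).2
  subst hpp
  have hcl₁ : (I₂ ++ [k] ++ i :: (W' ++ [p])).IsClosedChain D.Adj := by
    rw [hI]
    have h2 := h₁.closed.isChain.tail
    rw [hI] at h2
    have := List.isClosedChain_of_isChain (a := v') (L := I₂' ++ i :: W') (b := p)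
      (by simpa using h2) hp'v'
    simpa using this
  have hsp₁ : Spans (v :: (I₂ ++ [k] ++ i :: (W' ++ [p]))) := h₁.spans
  -- The arc from `p` to `v'` closes a cycle missing only `v`. A third in-neighbour `t` of `v`
  -- either gives a shorter chord or makes `v` insertable after `t`, contrary to its choice.
  obtain ⟨t, ht, hti, htp⟩ := hD.exists_inNeighbour v i p
  have htm : t ∈ I₂ ++ [k] ∨ t ∈ W' ++ [p] := by
    have htv : t ≠ v := by
      rintro rfl
      exact hD.loopless _ ht
    have := hsp₁.2 t
    simp only [List.mem_cons, List.mem_append, hti, htv, false_or, List.not_mem_nil,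
      or_false] at this ⊢
    tauto
  rcases htm with htm | htm
  · obtain ⟨A, B, hAB⟩ := List.append_of_mem htm
    have := h.length_le (IsChord.of_append_eq (i' := v) (I' := A) (k' := t)
        (W' := B ++ (W' ++ [p]) ++ [i]) (A := [i]) (B := v :: (A ++ t :: (B ++ (W' ++ [p]))))
        h.closed h.spans (by
          have := congrArg (fun K => i :: v :: (K ++ (W' ++ [p]))) hAB
          simpa using this) (by simp) (by simp) ht)
    have h2 := congrArg List.length hAB
    simp only [List.length_append, List.length_cons, List.length_nil] at this h2
    omega
  · obtain ⟨A, B, hAB⟩ := List.append_of_mem htm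
    rcases B with _ | ⟨s, B⟩
    · have := (List.append_inj' hAB rfl).2
      simp only [List.cons.injEq, and_true] at this
      exact htp this.symm
    · rw [hAB] at hcl₁ hsp₁ hins
      have hvs : D.Adj v s := by
        refine hB.adj_of_adj hD (A := I₂ ++ [k] ++ i :: A) (x := t) (B := B) ?_ ?_ ht
        · simpa using hcl₁
        · simpa using hsp₁
      exact hins ⟨t, s, ⟨I₂ ++ k :: A, B ++ [i], by simp⟩, ht, hvs⟩

/-- A Hamiltonian digraph satisfying the degree condition is not bypass-free. -/
theorem BypassFree.not_isClosedChain [Fintype V] (hB : D.BypassFree)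
    (hD : D.DominatedPairCondition) {C : List V} (hs : Spans C) : ¬ C.IsClosedChain D.Adj := by
  classical
  intro hC
  have hex : ∃ n i I k W, D.IsChord i I k W ∧ I.length = n := by
    rcases C with _ | ⟨x, L⟩
    · have := hs.length_eq
      have := hD.card
      simp at *
      omega
    rcases List.eq_nil_or_concat L with rfl | ⟨M, q, rfl⟩
    · have := hs.length_eq
      have := hD.card
      simp at *
      omega
    rw [List.concat_eq_append] at *
    obtain ⟨t, ht, htq, htx⟩ := hD.exists_inNeighbour x q x
    have htm : t ∈ M := by
      have := hs.2 t
      simpa [htq, htx] using this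
    obtain ⟨A, B, rfl⟩ := List.append_of_mem htm
    exact ⟨_, x, A, t, B ++ [q], ⟨by simpa using hC, by simpa using hs, by simp, ht⟩, rfl⟩
  obtain ⟨i, I, k, W, h, hI⟩ := Nat.find_spec hex
  exact hB.not_isShortestChord hD ⟨h, fun h' => hI.trans_le (Nat.find_min' hex ⟨_, _, _, _, h', rfl⟩)⟩

/-! ### Ears of a longest cycle and Hamiltonicity. -/

theorem Strong.exists_adj_not_mem (hD : D.Strong) {S : Set V} {x y : V} (hx : x ∈ S)
    (hy : y ∉ S) : ∃ u ∈ S, ∃ v ∉ S, D.Adj u v := by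
  by_contra! h
  refine hy ((hD x y).rec hx fun {b c} _ hbc hb => ?_)
  by_contra hc
  exact h b hb c hc hbc

theorem exists_path_to_set {S : Set V} {x y : V} (hxy : Relation.ReflTransGen D.Adj x y)
    (hy : y ∈ S) : x ∉ S → ∃ P b, (x :: (P ++ [b])).IsChain D.Adj ∧ (x :: P).Nodup ∧
      (∀ z ∈ x :: P, z ∉ S) ∧ b ∈ S := by
  induction hxy using Relation.ReflTransGen.head_induction_on with
  | refl => exact fun h => absurd hy h
  | @head x x' hxx' _ ih =>
    intro hx
    by_cases hx' : x' ∈ S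
    · exact ⟨[], x', by simpa using hxx', by simp, by simpa using hx, hx'⟩
    · obtain ⟨P, b, hc, hnd, hP, hb⟩ := ih hx'
      -- If `x` recurs, only the part of the path from that occurrence on is kept.
      by_cases hxP : x ∈ x' :: P
      · obtain ⟨A, B, hAB⟩ := List.append_of_mem hxP
        have e : x' :: (P ++ [b]) = A ++ (x :: (B ++ [b])) := by
          have := congrArg (· ++ [b]) hAB
          simpa using this
        rw [e] at hc
        rw [hAB] at hnd hP
        exact ⟨B, b, (List.isChain_append.1 hc).2.1, (List.nodup_append.1 hnd).2.1,
          fun z hz => hP z (List.mem_append_right _ hz), hb⟩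
      · refine ⟨x' :: P, b, ?_, List.nodup_cons.2 ⟨hxP, hnd⟩, ?_, hb⟩
        · rw [List.cons_append, List.isChain_cons_cons]
          exact ⟨hxx', hc⟩
        · intro z hz
          rcases List.mem_cons.1 hz with rfl | hz
          · exact hx
          · exact hP z hz

/-- In a strong digraph, every nonempty proper set of vertices has an ear. -/
theorem Strong.exists_ear (hD : D.Strong) {S : Set V} {x y : V} (hx : x ∈ S) (hy : y ∉ S) :
    ∃ a P b, a ∈ S ∧ b ∈ S ∧ P ≠ [] ∧ (a :: (P ++ [b])).IsChain D.Adj ∧ P.Nodup ∧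
      ∀ z ∈ P, z ∉ S := by
  obtain ⟨a, ha, p, hp, hap⟩ := hD.exists_adj_not_mem hx hy
  obtain ⟨P, b, hc, hnd, hP, hb⟩ := exists_path_to_set (hD p x) hx hp
  refine ⟨a, p :: P, b, ha, hb, by simp, ?_, hnd, hP⟩
  rw [List.cons_append, List.isChain_cons_cons]
  exact ⟨hap, hc⟩

/-- `a :: (I ++ W)` is a cycle of length `m`, and `P` is a nonempty path outside the cycle from
the vertex `a` to the vertex `b` of the cycle, which follows `I`. -/
structure IsEar (D : Digraph V) (m : ℕ) (a : V) (I W : List V) (b : V) (P : List V) : Prop where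
  closed : (a :: (I ++ W)).IsClosedChain D.Adj
  nodup : (a :: (I ++ W) ++ P).Nodup
  length : (a :: (I ++ W)).length = m
  -- For empty `W` this says `b = a`: an ear may return to its start.
  head : (W ++ [a]).head? = some b
  ne_nil : P ≠ []
  chain : (a :: (P ++ [b])).IsChain D.Adj

/-- An ear of a longest cycle (of length `m`) which skips as few vertices as possible. -/
structure IsShortestEar (D : Digraph V) (m : ℕ) (a : V) (I W : List V) (b : V) (P : List V) : Prop
    extends D.IsEar m a I W b P where
  length_le_of_isEar : ∀ {a' I' W' b' P'}, D.IsEar m a' I' W' b' P' → I.length ≤ I'.length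
  length_le : ∀ {C : List V}, C.Nodup → C.IsClosedChain D.Adj → C.length ≤ m

section ear

variable {m : ℕ} {a b p z : V} {I I₁ I₂ W R : List V}

theorem IsShortestEar.closed_comm (h : D.IsShortestEar m a I W b (p :: R)) :
    (W ++ [a] ++ I).IsClosedChain D.Adj := by
  simpa using List.IsClosedChain.append_comm (A := a :: I) (B := W) h.closed

theorem IsShortestEar.not_adj (h : D.IsShortestEar m a (I₁ ++ z :: I₂) W b (p :: R)) :
    ¬ D.Adj p z := by
  intro hpz
  have hc := h.chain
  simp only [List.cons_append, List.isChain_cons_cons] at hc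
  have hnd := h.nodup
  have := h.length_le_of_isEar (a' := a) (I' := I₁) (W' := z :: I₂ ++ W) (b' := z) (P' := [p])
    ⟨by simpa using h.closed,
      hnd.sublist (by
        simp),
      by simpa using h.length, by simp, by simp, by simpa using ⟨hc.1, hpz⟩⟩
  simp at this

/-- Such a path would be an ear starting at `z` and skipping only `I₂`. -/
theorem IsShortestEar.ear_of_adj (h : D.IsShortestEar m a (I₁ ++ z :: I₂) W b (p :: R))
    {P : List V} (hP : P ≠ []) (hc : (z :: (P ++ [b])).IsChain D.Adj)
    (hnd : P.Nodup) (hd : ∀ x ∈ P, x ∉ a :: (I₁ ++ z :: I₂ ++ W)) : False := by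
  classical
  have hhead := h.head
  have hcl : (z :: (I₂ ++ (W ++ a :: I₁))).IsClosedChain D.Adj := by
    simpa using List.IsClosedChain.append_comm (A := a :: I₁) (B := z :: (I₂ ++ W))
      (by simpa using h.closed)
  have hperm : (z :: (I₂ ++ (W ++ a :: I₁))).Perm (a :: (I₁ ++ z :: I₂ ++ W)) :=
    List.perm_of_forall_count fun x => by
      simp only [List.count_append, List.count_cons]; omega
  have hnd' := (List.nodup_append.1 h.nodup).1
  have := h.length_le_of_isEar (a' := z) (I' := I₂) (W' := W ++ a :: I₁) (b' := b) (P' := P)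
    ⟨hcl, by
      rw [List.nodup_append]
      refine ⟨hperm.nodup_iff.2 hnd', hnd, ?_⟩
      rintro x hx y hy rfl
      exact hd x hy (hperm.mem_iff.1 hx), hperm.length_eq.trans h.length, by
      cases W <;> simpa using hhead, hP, hc⟩
  simp at this
  omega

theorem IsShortestEar.not_mem (h : D.IsShortestEar m a I W b (p :: R)) :
    ∀ x ∈ p :: R, x ∉ a :: (I ++ W) := fun x hx hx' =>
  (List.nodup_append.1 h.nodup).2.2 x hx' x hx rfl

theorem IsShortestEar.not_adj' (h : D.IsShortestEar m a (I₁ ++ z :: I₂) W b (p :: R)) :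
    ¬ D.Adj z p := by
  intro hzp
  refine h.ear_of_adj (P := p :: R) (by simp) ?_ (List.nodup_append.1 h.nodup).2.1 h.not_mem
  have hc := h.chain
  simp only [List.cons_append, List.isChain_cons_cons] at hc ⊢
  exact ⟨hzp, hc.2⟩

theorem IsShortestEar.not_adj_adj (h : D.IsShortestEar m a (I₁ ++ z :: I₂) W b (p :: R))
    {w : V} (hw : w ∉ a :: (I₁ ++ z :: I₂ ++ W)) (hwp : w ≠ p) :
    ¬ (D.Adj p w ∧ D.Adj w z) := by
  rintro ⟨hpw, hwz⟩
  have hc := h.chain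
  simp only [List.cons_append, List.isChain_cons_cons] at hc
  have hp := h.not_mem p (by simp)
  have hnd := (List.nodup_append.1 h.nodup).1
  have := h.length_le_of_isEar (a' := a) (I' := I₁) (W' := z :: I₂ ++ W) (b' := z) (P' := [p, w])
    ⟨by simpa using h.closed, by
      rw [List.nodup_append]
      refine ⟨by simpa using hnd, by simpa using hwp.symm, ?_⟩
      rintro x hx y hy rfl
      simp only [List.mem_cons, List.not_mem_nil, or_false] at hy
      rcases hy with rfl | rfl
      · exact hp (by simpa using hx)
      · exact hw (by simpa using hx),
      by simpa using h.length, by simp, by simp, by simpa using ⟨hc.1, hpw, hwz⟩⟩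
  simp at this

theorem IsShortestEar.not_adj_adj' (h : D.IsShortestEar m a (I₁ ++ z :: I₂) W b (p :: R))
    {w : V} (hw : w ∉ a :: (I₁ ++ z :: I₂ ++ W)) :
    ¬ (D.Adj z w ∧ D.Adj w p) := by
  rintro ⟨hzw, hwp⟩
  have hc := h.chain.tail
  simp only [List.tail_cons] at hc
  have hnd := (List.nodup_append.1 h.nodup).2.1
  by_cases hwP : w ∈ p :: R
  · obtain ⟨A, B, hAB⟩ := List.append_of_mem hwP
    have hd := h.not_mem
    rw [hAB] at hnd hc hd
    rw [List.append_assoc] at hc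
    refine h.ear_of_adj (P := w :: B) (by simp) ?_ (List.nodup_append.1 hnd).2.1
      fun x hx => hd x (List.mem_append_right _ hx)
    rw [List.cons_append, List.isChain_cons_cons]
    exact ⟨hzw, (List.isChain_append.1 hc).2.1⟩
  · refine h.ear_of_adj (P := w :: p :: R) (by simp) ?_ (List.nodup_cons.2 ⟨hwP, hnd⟩) ?_
    · rw [List.cons_append, List.cons_append, List.isChain_cons_cons, List.isChain_cons_cons]
      exact ⟨hzw, hwp, hc⟩
    · intro x hx
      rcases List.mem_cons.1 hx with rfl | hx
      · exact hw
      · exact h.not_mem x hx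

theorem IsShortestEar.not_insertable (h : D.IsShortestEar m a I W b (p :: R)) :
    ¬ (W ++ [a]).Insertable D.Adj p := by
  classical
  rintro ⟨x, y, ⟨S, T, hST⟩, hx, hy⟩
  have hcl := h.closed_comm
  have e : W ++ [a] ++ I = S ++ x :: y :: (T ++ I) := by rw [← hST]; simp
  rw [e] at hcl
  have hperm : (S ++ x :: p :: y :: (T ++ I)).Perm (p :: (a :: (I ++ W))) := by
    refine List.perm_of_forall_count fun x => ?_
    have := congrArg (List.count x) hST
    simp only [List.count_append, List.count_cons, List.count_nil] at this ⊢; omega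
  have := h.length_le (hperm.nodup_iff.2 (List.nodup_cons.2
    ⟨h.not_mem p (by simp), (List.nodup_append.1 h.nodup).1⟩)) (hcl.insert hx hy)
  rw [hperm.length_eq, List.length_cons, h.length] at this
  omega

open Classical in
theorem exists_spans_append [Fintype V] {L : List V} (h : L.Nodup) :
    ∃ X, Spans (L ++ X) := by
  refine ⟨Finset.univ.toList.filter (· ∉ L), ?_, fun x => ?_⟩
  · rw [List.nodup_append]
    refine ⟨h, (Finset.nodup_toList _).filter _, ?_⟩
    rintro x hx y hy rfl
    simp at hy
    exact hy hx
  · simp only [List.mem_append, List.mem_filter, Finset.mem_toList, Finset.mem_univ, true_and,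
      decide_eq_true_eq]
    exact Classical.em _

theorem countP_add_countP_le_length {X : List V} {P Q : V → Prop} [DecidablePred P]
    [DecidablePred Q] (h : ∀ x ∈ X, ¬ (P x ∧ Q x)) :
    X.countP (fun x => P x) + X.countP (fun x => Q x) ≤ X.length := by
  induction X with
  | nil => simp
  | cons x X ih =>
    have h1 := ih fun y hy => h y (List.mem_cons_of_mem _ hy)
    have h2 := h x List.mem_cons_self
    simp only [List.countP_cons, List.length_cons, decide_eq_true_eq]
    by_cases hP : P x <;> by_cases hQ : Q x <;> simp only [hP, hQ, if_true, if_false] <;>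
      first | omega | exact absurd ⟨hP, hQ⟩ h2

open Classical in
theorem countP_le_of_not_insertable {Q : List V} {v : V} (hQ : Q ≠ [])
    (h : ¬ Q.Insertable D.Adj v) :
    Q.countP (fun x => D.Adj x v) + Q.countP (fun x => D.Adj v x) ≤ Q.length + 1 := by
  obtain ⟨e, f, he, hf, -, -, hc⟩ := List.exists_countP_add_countP_le
    (P := fun a => D.Adj a v) (Q := fun a => D.Adj v a) hQ
    fun a b hab hP => h ⟨a, b, hab, hP⟩
  omega

-- On `W ++ [a]` the vertex `p` contributes at most its length plus one, and nothing on the skipped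
-- segment; `z` contributes at most `Q.length + 1` on `Q` and two per vertex of `I₂`. Off the cycle,
-- paths of length two between `p` and `z` are excluded, so each vertex other than `p` counts at
-- most twice for both together.
open Classical in
theorem IsShortestEar.deg_add_deg_le [Fintype V] (hl : D.Loopless)
    (h : D.IsShortestEar m a (I₁ ++ z :: I₂) W b (p :: R)) {Q : List V}
    (hQ : Q.Perm (W ++ [a] ++ I₁)) (hz : ¬ Q.Insertable D.Adj z) :
    D.deg p + D.deg z + I₁.length + 2 ≤ 2 * Fintype.card V := by
  have hnd : (p :: z :: (I₁ ++ I₂ ++ (W ++ [a]))).Nodup := by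
    refine (List.Perm.nodup_iff (List.perm_of_forall_count fun x => ?_)).1
      (List.nodup_cons.2 ⟨h.not_mem p (by simp), (List.nodup_append.1 h.nodup).1⟩)
    simp only [List.count_append, List.count_cons, List.count_nil]; omega
  obtain ⟨X, hX⟩ := exists_spans_append hnd
  have hXC : ∀ w ∈ X, w ∉ a :: (I₁ ++ z :: I₂ ++ W) ∧ w ≠ p := by
    intro w hw
    have := (List.nodup_append.1 hX.1).2.2
    have h1 : w ∉ p :: z :: (I₁ ++ I₂ ++ (W ++ [a])) := fun h => this w h w hw rfl
    simp only [List.mem_append, List.mem_cons, List.not_mem_nil, or_false] at h1 ⊢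
    tauto
  have hs₁ : Spans (p :: ((W ++ [a]) ++ (I₁ ++ z :: I₂) ++ X)) := by
    refine hX.perm (List.perm_of_forall_count fun x => ?_)
    simp only [List.count_append, List.count_cons, List.count_nil]; omega
  have hs₂ : Spans (z :: (Q ++ (p :: I₂) ++ X)) := by
    refine hX.perm (List.perm_of_forall_count fun x => ?_)
    have := hQ.count_eq x
    simp only [List.count_append, List.count_cons, List.count_nil] at this ⊢; omega
  have h1 := countP_add_countP_le_length (X := X) (P := fun x => D.Adj p x)
    (Q := fun x => D.Adj x z) fun w hw => h.not_adj_adj (hXC w hw).1 (hXC w hw).2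
  have h2 := countP_add_countP_le_length (X := X) (P := fun x => D.Adj z x)
    (Q := fun x => D.Adj x p) fun w hw => h.not_adj_adj' (hXC w hw).1
  have h3 := countP_le_of_not_insertable (by simp) h.not_insertable
  have h4 := countP_le_of_not_insertable (by
    rintro rfl
    have := hQ.length_eq
    simp at this) hz
  have h5 : (I₁ ++ z :: I₂).countP (fun x => D.Adj p x) = 0 := by
    rw [List.countP_eq_zero]
    intro y hy
    obtain ⟨J, K, hJK⟩ := List.append_of_mem hy
    rw [hJK] at h
    simpa using h.not_adj
  have h6 : (I₁ ++ z :: I₂).countP (fun x => D.Adj x p) = 0 := by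
    rw [List.countP_eq_zero]
    intro y hy
    obtain ⟨J, K, hJK⟩ := List.append_of_mem hy
    rw [hJK] at h
    simpa using h.not_adj'
  have h7 := List.countP_le_length (p := fun y => decide (D.Adj z y)) (l := I₂)
  have h8 := List.countP_le_length (p := fun y => decide (D.Adj y z)) (l := I₂)
  have h9 := hs₂.length_eq
  have h10 := hQ.length_eq
  unfold deg
  rw [hs₁.outDeg_eq hl, hs₁.inDeg_eq hl, hs₂.outDeg_eq hl, hs₂.inDeg_eq hl]
  simp only [List.countP_append, List.countP_cons (l := I₂) (a := p)] at h3 h5 h6 ⊢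
  simp only [h.not_adj, h.not_adj', decide_false, Bool.false_eq_true, if_false]
  simp only [List.length_append, List.length_cons, List.length_nil] at h3 h9 h10
  omega

/-- If `I₁` is empty, `a` dominates `p` and `z`, and the sum condition contradicts `deg_add_deg_le`.
Otherwise the bound drops to `2n - 3`, so `d(p) ≥ n - 1` and `d(z) ≥ n - 1`, obtained from possibly
different pairs, suffice. -/
theorem IsShortestEar.insertable [Fintype V] (hD : D.DominatedPairCondition)
    (h : D.IsShortestEar m a (I₁ ++ z :: I₂) W b (p :: R)) {Q : List V} (hc : Q.IsChain D.Adj)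
    (hQ : Q.Perm (W ++ [a] ++ I₁)) (hlast : Q.getLast? = some a) : Q.Insertable D.Adj z := by
  by_contra hz
  have hsum := h.deg_add_deg_le hD.loopless hQ hz
  have hap : D.Adj a p := by
    have := h.chain
    simp only [List.cons_append, List.isChain_cons_cons] at this
    exact this.1
  have hna : ∀ z' J K, I₁ ++ z :: I₂ = J ++ z' :: K → D.NonAdjacent p z' := by
    intro z' J K e
    rw [e] at h
    refine ⟨?_, h.not_adj, h.not_adj'⟩
    rintro rfl
    exact h.not_mem p (by simp) (by simp)
  have hchain := h.closed.isChain
  rcases I₁ with _ | ⟨y, J⟩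
  · have haz : D.Adj a z := by
      simp at hchain
      exact hchain.1
    have := hD.le_deg_add (hna z [] I₂ rfl) ⟨a, hap, haz⟩
    simp at hsum
    omega
  have hay : D.Adj a y := by
    simp at hchain
    exact hchain.1
  have hp := hD.le_deg (hna y [] (J ++ z :: I₂) rfl) ⟨a, hap, hay⟩
  have hzdeg : Fintype.card V ≤ D.deg z + 1 := by
    have hnez : Q ≠ [] := by
      rintro rfl
      simp at hlast
    have hla : Q.getLast hnez = a := by
      rw [List.getLast?_eq_getLast_of_ne_nil hnez] at hlast
      simpa using hlast
    by_cases haz : D.Adj a z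
    · have h1 := hna z (y :: J) I₂ rfl
      exact hD.le_deg ⟨h1.1.symm, h1.2.2, h1.2.1⟩ ⟨a, haz, hap⟩
    · obtain ⟨K, w, hK⟩ : ∃ K w, y :: J = K ++ [w] := by
        rcases List.eq_nil_or_concat (y :: J) with hK | ⟨K, w, hK⟩
        · simp at hK
        · exact ⟨K, w, by simpa using hK⟩
      have hwz : D.Adj w z := by
        rw [hK] at hchain
        simp only [List.append_assoc, List.cons_append, List.nil_append] at hchain
        rw [List.isChain_cons_append_cons_cons] at hchain
        exact hchain.2.1
      obtain ⟨x, x', hxx, hxz, hx'z⟩ := List.exists_consecutive_of_mem_of_not_getLast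
        (P := fun x => D.Adj x z) hnez ⟨w, hQ.mem_iff.2 (by rw [hK]; simp), hwz⟩ (by rwa [hla])
      refine hD.le_deg (y := x') ⟨?_, fun hzx => hz ⟨x, x', hxx, hxz, hzx⟩, hx'z⟩ ⟨x, hxz, ?_⟩
      · rintro rfl
        have h1 := hQ.mem_iff.1 (hxx.subset (by simp : z ∈ [x, z]))
        have h2 := (List.nodup_append.1 h.nodup).1
        simp only [List.nodup_cons, List.nodup_append, List.mem_append, List.mem_cons,
          List.not_mem_nil, or_false] at h1 h2
        grind
      · have := hc.infix hxx
        simpa using this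
  simp at hsum
  omega

/-- Skipped vertices are inserted one at a time in cycle order; keeping `a` as last vertex is what
lets `insertable` be applied again. -/
theorem IsShortestEar.exists_insertion [Fintype V] (hD : D.DominatedPairCondition)
    (h : D.IsShortestEar m a I W b (p :: R)) (I₁ : List V) :
    ∀ I₂, I = I₁ ++ I₂ → ∃ Q : List V, Q.IsChain D.Adj ∧ Q.Perm (W ++ [a] ++ I₁) ∧
      Q.head? = (W ++ [a]).head? ∧ Q.getLast? = (W ++ [a]).getLast? := by
  induction I₁ using List.reverseRecOn with
  | nil =>
    exact fun I₂ _ => ⟨W ++ [a], h.closed_comm.isChain.prefix ⟨I, rfl⟩, by simp, rfl, rfl⟩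
  | append_singleton I₁ z ih =>
    intro I₂ hI
    obtain ⟨Q, hc, hQ, hhead, hlast⟩ := ih (z :: I₂) (by simpa using hI)
    have e : I = I₁ ++ z :: I₂ := by simpa using hI
    have hz := (e ▸ h).insertable hD hc hQ (by simpa using hlast)
    obtain ⟨Q', hc', hQ', hhead', hlast'⟩ := List.exists_multi_insertion 1 [z] (by simp) Q
      (by simp) hc (by simpa using hz)
    refine ⟨Q', hc', hQ'.trans ?_, hhead'.trans hhead, hlast'.trans hlast⟩
    rw [← List.append_assoc]
    exact hQ.append_right _

theorem not_isShortestEar [Fintype V] (hD : D.DominatedPairCondition) :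
    ¬ D.IsShortestEar m a I W b (p :: R) := by
  intro h
  obtain ⟨Q, hc, hQ, hhead, hlast⟩ := h.exists_insertion hD I [] (by simp)
  have hperm : (W ++ [a] ++ I).Perm (a :: (I ++ W)) := by
    classical
    refine List.perm_of_forall_count fun x => ?_
    simp only [List.count_append, List.count_cons, List.count_nil]; omega
  have hnd : (Q ++ p :: R).Nodup :=
    (((hQ.trans hperm).append_right _).nodup_iff).2 h.nodup
  have hcl : (Q ++ p :: R).IsClosedChain D.Adj := by
    obtain ⟨K, rfl⟩ : ∃ K, Q = b :: K := by
      rw [h.head] at hhead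
      rcases Q with _ | ⟨b', K⟩
      · simp at hhead
      · exact ⟨K, by simpa using hhead⟩
    rw [List.cons_append, List.isClosedChain_cons, List.append_assoc, ← List.cons_append,
      List.isChain_append]
    refine ⟨hc, h.chain.tail, ?_⟩
    intro x hx y hy
    have hch := h.chain
    simp only [List.cons_append, List.isChain_cons_cons] at hch
    have h1 : a = x := by simpa [hlast] using hx
    have h2 : p = y := by simpa using hy
    exact h1 ▸ h2 ▸ hch.1
  have h1 := h.length_le hnd hcl
  have h2 := h.length
  rw [List.length_append, (hQ.trans hperm).length_eq] at h1
  simp at h1 h2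
  omega

end ear

/-- A strong digraph satisfying the degree condition is Hamiltonian. -/
theorem DominatedPairCondition.exists_isClosedChain [Fintype V] (hD : D.DominatedPairCondition)
    (hstrong : D.Strong) : ∃ C, Spans C ∧ C.IsClosedChain D.Adj := by
  classical
  have hbound : ∀ {C : List V}, C.Nodup → C.length ≤ Fintype.card V := fun h =>
    h.length_le_card
  have hne : Nonempty V := Fintype.card_pos_iff.1 (by have := hD.card; omega)
  obtain ⟨x⟩ := hne
  obtain ⟨y, hyx, -, -⟩ := hD.exists_inNeighbour x x x
  have hxy : y ≠ x := by
    rintro rfl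
    exact hD.loopless _ hyx
  -- A longest cycle is found by minimising the number of missed vertices; some cycle exists, namely
  -- an ear of a single vertex.
  have hex : ∃ m, ∃ C : List V, C ≠ [] ∧ C.Nodup ∧ C.IsClosedChain D.Adj ∧
      Fintype.card V - C.length = m := by
    obtain ⟨a, P, b, ha, hb, hP, hc, hnd, hd⟩ := hstrong.exists_ear (S := {x}) rfl hxy
    obtain rfl : a = x := ha
    obtain rfl : b = a := hb
    exact ⟨_, b :: P, by simp, List.nodup_cons.2 ⟨fun h => hd b h rfl, hnd⟩,
      List.isClosedChain_cons.2 hc, rfl⟩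
  obtain ⟨C, hC, hnd, hcl, hm⟩ := Nat.find_spec hex
  have hmax : ∀ {C' : List V}, C'.Nodup → C'.IsClosedChain D.Adj → C'.length ≤ C.length := by
    intro C' hnd' hcl'
    rcases eq_or_ne C' [] with rfl | hC'
    · simp
    have := Nat.find_min' hex ⟨C', hC', hnd', hcl', rfl⟩
    have := hbound hnd
    have := hbound hnd'
    omega
  refine ⟨C, ⟨hnd, ?_⟩, hcl⟩
  by_contra! hw
  obtain ⟨w, hw⟩ := hw
  obtain ⟨c, hc⟩ := List.exists_mem_of_ne_nil C hC
  obtain ⟨a, P, b, ha, hb, hP, hch, hndP, hd⟩ :=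
    hstrong.exists_ear (S := {x | x ∈ C}) (x := c) (y := w) hc hw
  have hear : ∃ k a I W b P, D.IsEar C.length a I W b P ∧ I.length = k := by
    obtain ⟨A, B, rfl⟩ := List.append_of_mem ha
    have hperm : (a :: (B ++ A)).Perm (A ++ a :: B) := by
      rw [← List.cons_append]
      exact List.perm_append_comm
    have hcl' : (a :: (B ++ A)).IsClosedChain D.Adj := hcl.append_comm
    have hb' : b ∈ B ++ A ++ [a] := by
      simp only [Set.mem_ofPred_eq, List.mem_append, List.mem_cons, List.not_mem_nil] at hb ⊢
      tauto
    obtain ⟨I, W, hIW, hhead⟩ : ∃ I W, B ++ A = I ++ W ∧ (W ++ [a]).head? = some b := by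
      rcases List.mem_append.1 hb' with h | h
      · obtain ⟨I, W, h⟩ := List.append_of_mem h
        exact ⟨I, b :: W, h, by simp⟩
      · exact ⟨B ++ A, [], by simp, by simpa [eq_comm] using h⟩
    rw [hIW] at hperm hcl'
    refine ⟨_, a, I, W, b, P, ⟨hcl', ?_, hperm.length_eq, hhead, hP, hch⟩, rfl⟩
    rw [List.nodup_append]
    refine ⟨hperm.nodup_iff.2 hnd, hndP, ?_⟩
    rintro u hu v hv rfl
    exact hd u hv (hperm.mem_iff.1 hu)
  obtain ⟨a, I, W, b, P, h, hI⟩ := Nat.find_spec hear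
  rcases P with _ | ⟨p, R⟩
  · exact h.ne_nil rfl
  · exact not_isShortestEar hD
      ⟨h, fun h' => hI.trans_le (Nat.find_min' hear ⟨_, _, _, _, _, h', rfl⟩), hmax⟩

end Digraph

theorem theorem12 {V : Type*} [Fintype V] (D : Digraph V) (hloop : D.Loopless)
    (n : ℕ) (hn : Fintype.card V = n) (hn4 : 4 ≤ n)
    (hstrong : D.Strong)
    (hout : ∀ v, 2 ≤ D.outDeg v) (hin : ∀ v, 3 ≤ D.inDeg v)
    (hdeg : ∀ x y, D.NonAdjacent x y → D.HasCommonInNeighbour x y →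
      n - 1 ≤ min (D.deg x) (D.deg y) ∧ 2 * n - 1 ≤ D.deg x + D.deg y) :
    D.ContainsHamiltonianBypass := by
  subst hn
  have hD : D.DominatedPairCondition :=
    { loopless := hloop
      card := hn4
      inDeg := hin
      le_deg := fun {x y} h h' => by
        have := (hdeg x y h h').1.trans (min_le_left _ _)
        omega
      le_deg_add := fun {x y} h h' => by
        have := (hdeg x y h h').2
        omega }
  refine Digraph.containsHamiltonianBypass_of_not_bypassFree (by omega) fun hB => ?_
  obtain ⟨C, hs, hC⟩ := hD.exists_isClosedChain hstrong
  exact hB.not_isClosedChain hD hs hC
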